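/- For positive integers $D,n$ let $\Lambda$ be the graph with vertex set $\{0,\dots,n-1\}^D$ in which $\mathbf{x},\mathbf{y}$ are adjacent iff their Lee distance $\sum_{i=1}^D \min(|x_i-y_i|,\,n-|x_i-y_i|)$ equals $1$ (the $D$-dimensional lattice with periodic boundary conditions). Put one qubit on each vertex; the graph state $|\mathrm{G}\rangle$ of $\Lambda$ is the unit vector, unique up to a global phase, with $X_v\prod_{w\sim v}Z_w\,|\mathrm{G}\rangle=|\mathrm{G}\rangle$ for all vertices $v$. For a binary linear code $\mathcal{C}\subseteq\mathbb{F}_2^{n^D}$ with coordinates indexed by the vertices, the associated codeword stabilized (CWS) code is $\mathcal{Q}=\operatorname{span}_{\mathbb{C}}\{Z_{\mathbf{c}}|\mathrm{G}\rangle:\mathbf{c}\in\mathcal{C}\}$, where $Z_{\mathbf{c}}=\prod_v Z_v^{c_v}$. A pure $[[N,k,d]]$ quantum code is a $2^k$-dimensional subspace $\mathcal{Q}$ of $(\mathbb{C}^2)^{\otimes N}$ such that $\langle\psi|E|\psi\rangle=0$ for all $|\psi\rangle\in\mathcal{Q}$ and all Pauli operators $E$ of weight strictly between $0$ and $d$.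 Let $D\ge 1$ and $n\ge 8$ be integers, and suppose that $k:=n^D-\lceil 2D^2(2D+1)\log_2 n\rceil\ge 0$. Then there is a binary linear code $\mathcal{C}$ of length $n^D$ and dimension $k$, all of whose non-zero codewords have Hamming weight greater than $2D(2D+1)$, such that the CWS code constructed from the graph state of $\Lambda$ and $\mathcal{C}$ is a pure $[[n^D,k,2D+1]]$ quantum code. -/

import Mathlib

noncomputable section

namespace CWS

/-- The Hilbert space `(ℂ²)^{⊗ V}` of qubits labelled by `V`, written in the computational basis
`|x⟩`, `x ∈ {0,1}^V`: a vector is its family of amplitudes, with the Euclidean inner product. -/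
abbrev QubitSpace (V : Type*) : Type _ := EuclideanSpace ℂ (V → ZMod 2)

variable {V : Type*} [Fintype V] [DecidableEq V]

/-- `X_a = ∏_j X_j^{a_j}`: it maps `|x⟩` to `|x + a⟩`, hence has amplitudes
`(X_a ψ)(x) = ψ(x + a)` (addition modulo 2). -/
def pauliX (a : V → ZMod 2) : QubitSpace V →ₗ[ℂ] QubitSpace V where
  toFun ψ := WithLp.toLp 2 fun x => ψ (x + a)
  map_add' _ _ := by ext; simp
  map_smul' _ _ := by ext; simp

/-- `Z_b = ∏_j Z_j^{b_j}`: it maps `|x⟩` to `(-1)^{b · x} |x⟩`. -/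
def pauliZ (b : V → ZMod 2) : QubitSpace V →ₗ[ℂ] QubitSpace V where
  toFun ψ := WithLp.toLp 2 fun x => (-1 : ℂ) ^ (b ⬝ᵥ x).val * ψ x
  map_add' _ _ := by ext; simp [mul_add]
  map_smul' _ _ := by ext; simp [mul_left_comm]

/-- The element `i^p X_a Z_b` of the Pauli group. Every element of the Pauli group has this form
(for instance `Y = i X Z` on one qubit). -/
def pauliOp (p : Fin 4) (a b : V → ZMod 2) : QubitSpace V →ₗ[ℂ] QubitSpace V :=
  Complex.I ^ (p : ℕ) • (pauliX a ∘ₗ pauliZ b)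

/-- The weight of the Pauli operator `i^p X_a Z_b`: the number of qubits on which it is not a
multiple of the identity. -/
def pauliWeight (a b : V → ZMod 2) : ℕ :=
  (Finset.univ.filter fun j => (a j, b j) ≠ (0, 0)).card

/-- `Q` is a pure `[[N, k, d]]` quantum code on the qubits `V`: there are `N` qubits, `Q` is a
`2^k`-dimensional subspace, and `⟨ψ|E|ψ⟩ = 0` for every `ψ ∈ Q` and every Pauli operator `E` of
weight strictly between `0` and `d`. -/
def IsPureCode (N k d : ℕ) (Q : Submodule ℂ (QubitSpace V)) : Prop :=
  Fintype.card V = N ∧ Module.finrank ℂ Q = 2 ^ k ∧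
    ∀ (p : Fin 4) (a b : V → ZMod 2), 0 < pauliWeight a b → pauliWeight a b < d →
      ∀ ψ ∈ Q, inner ℂ ψ (pauliOp p a b ψ) = 0

open Classical in
/-- The stabilizer generator `S_i = X_i Z_{N(i)}` of the vertex `i` of the graph `G`. -/
def stabGen (G : SimpleGraph V) (i : V) : QubitSpace V →ₗ[ℂ] QubitSpace V :=
  pauliX (Pi.single i 1) ∘ₗ pauliZ (fun j => if G.Adj i j then 1 else 0)

/-- `ψ` is the graph state of `G` (which is unique up to a global phase): a unit vector that is a
simultaneous `+1`-eigenvector of all stabilizer generators. -/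
def IsGraphState (G : SimpleGraph V) (ψ : QubitSpace V) : Prop :=
  ‖ψ‖ = 1 ∧ ∀ i, stabGen G i ψ = ψ

/-- The codeword stabilized code `span {Z_c |G⟩ : c ∈ C}` of a state and a binary linear code. -/
def cwsCode (ψ : QubitSpace V) (C : Submodule (ZMod 2) (V → ZMod 2)) :
    Submodule ℂ (QubitSpace V) :=
  Submodule.span ℂ ((fun c => pauliZ c ψ) '' (C : Set (V → ZMod 2)))

/-- The Lee distance on `∏ i, {0, …, n i - 1}`. -/
def leeDist {D : ℕ} {n : Fin D → ℕ} (x y : ∀ i, Fin (n i)) : ℕ :=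
  ∑ i, min ((x i : ℤ) - (y i : ℤ)).natAbs (n i - ((x i : ℤ) - (y i : ℤ)).natAbs)

/-- The `D`-dimensional rectangular lattice with periodic boundary conditions and side lengths
`n 0, …, n (D - 1)`. -/
def torusLattice {D : ℕ} (n : Fin D → ℕ) : SimpleGraph (∀ i, Fin (n i)) where
  Adj x y := leeDist x y = 1
  symm := ⟨fun x y h => by
    have e : leeDist y x = leeDist x y := by
      unfold leeDist
      refine Finset.sum_congr rfl fun i _ => ?_
      rw [← Int.natAbs_neg, neg_sub]
    exact e.trans h⟩
  loopless := ⟨fun x h => by simp [leeDist] at h⟩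

end CWS

end

/-! On a graph state a bit flip pattern `a` acts, up to a scalar, as the phase flip pattern Γa,
where Γ is the adjacency matrix over 𝔽₂ (`neighborSum`). So a Pauli operator with parts `a`, `b`
sends Z_c|G⟩ to a multiple of Z_{c+b+Γa}|G⟩. These vectors are orthonormal as `c` varies, hence all
matrix elements on the code vanish when b + Γa ∉ C.

If the Pauli weight is at most 2D, then b + Γa has weight at most 2D + 2D·2D = 2D(2D+1), because Γ
multiplies weight by at most 2D. If C has no non-zero word that light, the only dangerous case is b
= Γa: the operator is a phase times a stabilizer element. Non-trivial stabilizer elements have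
weight at least 2D+1 (`le_pauliWeight_neighborSum_torusLattice`), by induction on D: slicing along
one cyclic direction gains 2 (`cyclic_weight_bound`).

The code C comes from a Gilbert–Varshamov argument (`exists_linearCode`). -/

namespace CWS

/-! ### Graph states, Pauli operators and CWS codes -/

section

variable {V : Type*} [Fintype V]

/-- The sign `(-1)^a` of a bit `a`. -/
noncomputable def bitSign (a : ZMod 2) : ℂ := (-1) ^ a.val

theorem bitSign_zero : bitSign 0 = 1 := by simp [bitSign]

theorem bitSign_add (a b : ZMod 2) : bitSign (a + b) = bitSign a * bitSign b := by
  revert a b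
  have h : ∀ a : ZMod 2, a = 0 ∨ a = 1 := by decide
  intro a b
  have e : (1 + 1 : ZMod 2) = 0 := by decide
  have e1 : (1 : ZMod 2).val = 1 := by decide
  rcases h a with rfl | rfl <;> rcases h b with rfl | rfl <;> simp [bitSign, e, e1]

theorem bitSign_mul_self (a : ZMod 2) : bitSign a * bitSign a = 1 := by
  rw [← bitSign_add, CharTwo.add_self_eq_zero, bitSign_zero]

theorem norm_bitSign (a : ZMod 2) : ‖bitSign a‖ = 1 := by simp [bitSign]

theorem star_bitSign (a : ZMod 2) : (starRingEnd ℂ) (bitSign a) = bitSign a := by simp [bitSign]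

theorem bitSign_one : bitSign 1 = -1 := by
  have e1 : (1 : ZMod 2).val = 1 := by decide
  simp [bitSign, e1]

/-- Flipping one coordinate in the support of `c` permutes the terms and negates each of them. -/
theorem sum_bitSign_dotProduct [DecidableEq V] (c : V → ZMod 2) (hc : c ≠ 0) :
    ∑ x : V → ZMod 2, bitSign (c ⬝ᵥ x) = 0 := by
  obtain ⟨i, hi⟩ := Function.ne_iff.mp hc
  have hi1 : c i = 1 := by
    have h : ∀ a : ZMod 2, a ≠ 0 → a = 1 := by decide
    exact h _ hi
  have h := Equiv.sum_comp (Equiv.addRight (Pi.single i (1 : ZMod 2)))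
    (fun x : V → ZMod 2 => bitSign (c ⬝ᵥ x))
  simp only [Equiv.coe_addRight, dotProduct_add, bitSign_add, dotProduct_single, hi1, mul_one,
    bitSign_one, mul_neg, Finset.sum_neg_distrib] at h
  exact self_eq_neg.mp h.symm

open Classical in
/-- The adjacency matrix of `G` over `𝔽₂` applied to a vector. -/
noncomputable def neighborSum (G : SimpleGraph V) (a : V → ZMod 2) : V → ZMod 2 :=
  fun v => ∑ w, if G.Adj v w then a w else 0

theorem neighborSum_add (G : SimpleGraph V) (a b : V → ZMod 2) :
    neighborSum G (a + b) = neighborSum G a + neighborSum G b := by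
  classical
  ext v
  simp only [neighborSum, Pi.add_apply, ← Finset.sum_add_distrib]
  exact Finset.sum_congr rfl fun w _ => by split_ifs <;> simp

theorem neighborSum_zero (G : SimpleGraph V) : neighborSum G 0 = 0 := by
  ext v
  simp [neighborSum]

theorem pauliZ_apply (b : V → ZMod 2) (ψ : QubitSpace V) (x : V → ZMod 2) :
    pauliZ b ψ x = bitSign (b ⬝ᵥ x) * ψ x := rfl

variable [DecidableEq V]

open Classical in
theorem stabGen_apply (G : SimpleGraph V) (i : V) (ψ : QubitSpace V) (x : V → ZMod 2) :
    stabGen G i ψ x = bitSign ((fun j => if G.Adj i j then 1 else 0) ⬝ᵥ x) *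
      ψ (x + Pi.single i 1) := by
  have : stabGen G i ψ x = bitSign ((fun j => if G.Adj i j then 1 else 0) ⬝ᵥ
    (x + Pi.single i 1)) * ψ (x + Pi.single i 1) := rfl
  rw [this, dotProduct_add, dotProduct_single]
  simp

open Classical in
theorem neighborSum_single (G : SimpleGraph V) (i : V) :
    neighborSum G (Pi.single i 1) = fun j => if G.Adj i j then 1 else 0 := by
  ext v
  simp only [neighborSum]
  rw [Finset.sum_eq_single i]
  · simp [G.adj_comm]
  · intro w _ hw
    simp [hw]
  · simp

/-- On a graph state, a bit flip pattern acts as a phase flip pattern. -/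
theorem IsGraphState.apply_add {G : SimpleGraph V} {ψ : QubitSpace V} (hψ : IsGraphState G ψ)
    (a : V → ZMod 2) :
    ∃ ε : ℂ, ‖ε‖ = 1 ∧ ∀ x, ψ (x + a) = ε * bitSign (neighborSum G a ⬝ᵥ x) * ψ x := by
  classical
  rw [← Finset.univ_sum_single a]
  refine Finset.sum_induction _ (fun a => ∃ ε : ℂ, ‖ε‖ = 1 ∧
    ∀ x, ψ (x + a) = ε * bitSign (neighborSum G a ⬝ᵥ x) * ψ x) ?_ ?_ ?_
  · rintro a b ⟨ε, hε, ha⟩ ⟨δ, hδ, hb⟩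
    -- The extra sign arises from evaluating the phase pattern of `b` at `x + a` rather than at `x`.
    refine ⟨ε * δ * bitSign (neighborSum G b ⬝ᵥ a), by simp [hε, hδ, norm_bitSign], fun x => ?_⟩
    rw [← add_assoc, hb, ha, neighborSum_add, dotProduct_add, add_dotProduct, bitSign_add,
      bitSign_add]
    ring
  · exact ⟨1, by simp, fun x => by simp [neighborSum_zero, bitSign_zero]⟩
  · intro i _
    have h : ∀ b : ZMod 2, b = 0 ∨ b = 1 := by decide
    rcases h (a i) with h | h <;> rw [h]
    · exact ⟨1, by simp, fun x => by simp [neighborSum_zero, bitSign_zero]⟩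
    · refine ⟨1, by simp, fun x => ?_⟩
      have hx := stabGen_apply G i ψ x
      rw [hψ.2 i] at hx
      rw [neighborSum_single, hx, one_mul, ← mul_assoc, bitSign_mul_self, one_mul]

theorem IsGraphState.norm_apply {G : SimpleGraph V} {ψ : QubitSpace V} (hψ : IsGraphState G ψ)
    (x : V → ZMod 2) : ‖ψ x‖ = ‖ψ 0‖ := by
  obtain ⟨ε, hε, h⟩ := hψ.apply_add x
  rw [← zero_add x, h 0]
  simp [hε, norm_bitSign]

/-- All amplitudes have the same modulus, so the inner product is a multiple of the sum of the
non-trivial character `c + d`. -/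
theorem IsGraphState.inner_pauliZ {G : SimpleGraph V} {ψ : QubitSpace V} (hψ : IsGraphState G ψ)
    {c d : V → ZMod 2} (hcd : c ≠ d) : inner ℂ (pauliZ c ψ) (pauliZ d ψ) = 0 := by
  have key : ∀ x, inner ℂ (pauliZ c ψ x) (pauliZ d ψ x) =
      bitSign ((c + d) ⬝ᵥ x) * (‖ψ 0‖ : ℂ) ^ 2 := by
    intro x
    rw [pauliZ_apply, pauliZ_apply, RCLike.inner_apply, map_mul, star_bitSign, add_dotProduct,
      bitSign_add, ← hψ.norm_apply x, ← Complex.mul_conj']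
    ring
  rw [PiLp.inner_apply]
  simp only [key]
  rw [← Finset.sum_mul, sum_bitSign_dotProduct, zero_mul]
  intro h
  exact hcd (by rwa [← ZModModule.sub_eq_add, sub_eq_zero] at h)

theorem norm_pauliZ (c : V → ZMod 2) (ψ : QubitSpace V) : ‖pauliZ c ψ‖ = ‖ψ‖ := by
  rw [EuclideanSpace.norm_eq, EuclideanSpace.norm_eq]
  simp [pauliZ_apply, norm_bitSign]

theorem IsGraphState.orthonormal_pauliZ {G : SimpleGraph V} {ψ : QubitSpace V}
    (hψ : IsGraphState G ψ) : Orthonormal ℂ fun c : V → ZMod 2 => pauliZ c ψ :=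
  ⟨fun c => (norm_pauliZ c ψ).trans hψ.1, fun _ _ h => hψ.inner_pauliZ h⟩

theorem IsGraphState.finrank_cwsCode {G : SimpleGraph V} {ψ : QubitSpace V}
    (hψ : IsGraphState G ψ) (C : Submodule (ZMod 2) (V → ZMod 2)) :
    Module.finrank ℂ (cwsCode ψ C) = 2 ^ Module.finrank (ZMod 2) C := by
  classical
  have hli : LinearIndependent ℂ fun c : C => pauliZ (c : V → ZMod 2) ψ :=
    hψ.orthonormal_pauliZ.linearIndependent.comp _ Subtype.val_injective
  have h := finrank_span_eq_card hli
  rw [cwsCode, Set.image_eq_range]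
  refine h.trans ?_
  rw [Module.card_eq_pow_finrank (K := ZMod 2), ZMod.card]

/-- Reduces quantum errors to classical ones: the induced error is `b + neighborSum G a`. Only
orthogonality is needed later, so the modulus of `ε` is not recorded. -/
theorem IsGraphState.pauliOp_pauliZ {G : SimpleGraph V} {ψ : QubitSpace V}
    (hψ : IsGraphState G ψ) (p : Fin 4) (a b c : V → ZMod 2) :
    ∃ ε : ℂ, pauliOp p a b (pauliZ c ψ) = ε • pauliZ (c + (b + neighborSum G a)) ψ := by
  obtain ⟨ε, -, h⟩ := hψ.apply_add a
  refine ⟨Complex.I ^ (p : ℕ) * (ε * bitSign ((b + c) ⬝ᵥ a)), ?_⟩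
  ext x
  have e : pauliOp p a b (pauliZ c ψ) x = Complex.I ^ (p : ℕ) *
    (bitSign (b ⬝ᵥ (x + a)) * (bitSign (c ⬝ᵥ (x + a)) * ψ (x + a))) := rfl
  rw [e, PiLp.smul_apply, pauliZ_apply, h]
  simp only [dotProduct_add, add_dotProduct, bitSign_add, smul_eq_mul]
  ring

/-- A CWS code detects, purely, every Pauli operator whose induced phase flip pattern lies
outside the classical code. -/
theorem IsGraphState.inner_pauliOp_eq_zero {G : SimpleGraph V} {ψ : QubitSpace V}
    (hψ : IsGraphState G ψ) {C : Submodule (ZMod 2) (V → ZMod 2)} (p : Fin 4)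
    {a b : V → ZMod 2} (hab : b + neighborSum G a ∉ C) {φ χ : QubitSpace V}
    (hφ : φ ∈ cwsCode ψ C) (hχ : χ ∈ cwsCode ψ C) : inner ℂ φ (pauliOp p a b χ) = 0 := by
  induction hφ using Submodule.span_induction with
  | zero => exact inner_zero_left _
  | add x y _ _ hx hy => rw [inner_add_left, hx, hy, add_zero]
  | smul r x _ hx => rw [inner_smul_left, hx, mul_zero]
  | mem x hx =>
    obtain ⟨c, hc, rfl⟩ := hx
    induction hχ using Submodule.span_induction with
    | zero => rw [map_zero, inner_zero_right]
    | add x y _ _ hx hy => rw [map_add, inner_add_right, hx, hy, add_zero]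
    | smul r x _ hx => rw [map_smul, inner_smul_right, hx, mul_zero]
    | mem x hx =>
      obtain ⟨d, hd, rfl⟩ := hx
      obtain ⟨ε, hε⟩ := hψ.pauliOp_pauliZ p a b d
      dsimp only
      rw [hε, inner_smul_right, hψ.inner_pauliZ, mul_zero]
      rintro rfl
      exact hab ((Submodule.add_mem_iff_right C hd).mp hc)

/-- Every finite graph has a graph state. -/
theorem exists_isGraphState (G : SimpleGraph V) : ∃ ψ, IsGraphState G ψ := by
  classical
  let e := Fintype.equivFin V
  -- Ordering the vertices makes the quadratic form of `U` count each edge once, while U + Uᵀ is the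
  -- adjacency matrix.
  let U : Matrix V V (ZMod 2) := Matrix.of fun i j => if G.Adj i j ∧ e i < e j then 1 else 0
  let φ : QubitSpace V := WithLp.toLp 2 fun x => bitSign (x ⬝ᵥ U.mulVec x)
  have hφ : ∀ i, stabGen G i φ = φ := by
    intro i
    ext x
    rw [stabGen_apply]
    change _ * bitSign _ = bitSign _
    rw [← bitSign_add]
    congr 1
    have h1 : U.mulVec (Pi.single i 1) = fun j => U j i := by
      ext j; simp
    have h2 : (Pi.single i 1 : V → ZMod 2) ⬝ᵥ U.mulVec x = (fun j => U i j) ⬝ᵥ x := by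
      simp [Matrix.mulVec]
    have h3 : (fun j => if G.Adj i j then (1 : ZMod 2) else 0) =
        (fun j => U j i) + fun j => U i j := by
      ext j
      simp only [U, Matrix.of_apply, Pi.add_apply, G.adj_comm j i]
      by_cases h : G.Adj i j
      · have hne : e i ≠ e j := fun h' => h.ne (e.injective h')
        rcases lt_or_gt_of_ne hne with h' | h' <;> simp [h, h', h'.not_gt]
      · simp [h]
    have h4 : U i i = 0 := by simp [U]
    rw [Matrix.mulVec_add, dotProduct_add, add_dotProduct, add_dotProduct, h2, h1, h3,
      add_dotProduct, single_dotProduct, h4,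
      dotProduct_comm x fun j => U j i]
    generalize (fun j => U j i) ⬝ᵥ x = u
    generalize (fun j => U i j) ⬝ᵥ x = v
    linear_combination u * CharTwo.two_eq_zero (R := ZMod 2) + v * CharTwo.two_eq_zero (R := ZMod 2)
  have hne : φ ≠ 0 := by
    intro h
    have h0 := congrArg (fun f : QubitSpace V => ‖f 0‖) h
    have h1 : ‖φ 0‖ = 1 := norm_bitSign _
    simp only [h1] at h0
    simp at h0
  refine ⟨(‖φ‖⁻¹ : ℂ) • φ, norm_smul_inv_norm hne, fun i => ?_⟩
  rw [map_smul, hφ]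

end

/-! ### Hamming balls and the Gilbert–Varshamov bound -/

section

variable {V : Type*} [Fintype V] [DecidableEq V]

/-- A non-zero word of weight at most t + 1 is one bit flip away from a word of weight at most t. -/
theorem card_hammingNorm_le_succ (t : ℕ) :
    (Finset.univ.filter fun x : V → ZMod 2 => hammingNorm x ≤ t + 1).card ≤
      1 + Fintype.card V * (Finset.univ.filter fun x : V → ZMod 2 => hammingNorm x ≤ t).card := by
  classical
  have hsub : (Finset.univ.filter fun x : V → ZMod 2 => hammingNorm x ≤ t + 1) ⊆
      {0} ∪ ((Finset.univ : Finset V) ×ˢ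
        (Finset.univ.filter fun x : V → ZMod 2 => hammingNorm x ≤ t)).image
          fun p => p.2 + Pi.single p.1 1 := by
    intro x hx
    simp only [Finset.mem_filter, Finset.mem_univ, true_and] at hx
    by_cases h0 : x = 0
    · simp [h0]
    obtain ⟨i, hi⟩ := Function.ne_iff.mp h0
    refine Finset.mem_union_right _ (Finset.mem_image.mpr ⟨(i, x + Pi.single i 1), ?_, ?_⟩)
    · simp only [Finset.mem_product, Finset.mem_univ, Finset.mem_filter, true_and]
      have hlt : hammingNorm (x + Pi.single i 1) < hammingNorm x := by
        refine Finset.card_lt_card ⟨fun j hj => ?_, fun h => ?_⟩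
        · simp only [Finset.mem_filter, Finset.mem_univ, true_and] at hj ⊢
          by_cases hji : j = i
          · rwa [hji]
          · simpa [hji] using hj
        · have hmem := h (Finset.mem_filter.mpr ⟨Finset.mem_univ i, hi⟩)
          simp only [Finset.mem_filter, Finset.mem_univ, true_and, Pi.add_apply,
            Pi.single_eq_same] at hmem
          have : ∀ b : ZMod 2, b ≠ 0 → b + 1 = 0 := by decide
          exact hmem (this _ hi)
      omega
    · ext j
      simp [add_assoc, ZModModule.add_self]
  refine (Finset.card_le_card hsub).trans ((Finset.card_union_le _ _).trans ?_)
  gcongr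
  · simp
  · exact Finset.card_image_le.trans (by simp)

theorem card_hammingNorm_le_lt (hV : 2 ≤ Fintype.card V) (t : ℕ) :
    (Finset.univ.filter fun x : V → ZMod 2 => hammingNorm x ≤ t).card <
      2 * Fintype.card V ^ t := by
  induction t with
  | zero =>
    simp [hammingNorm_eq_zero, Finset.filter_eq']
  | succ t ih =>
    refine (card_hammingNorm_le_succ t).trans_lt ?_
    generalize (Finset.univ.filter fun x : V → ZMod 2 => hammingNorm x ≤ t).card = B at ih
    calc 1 + Fintype.card V * B < Fintype.card V * (B + 1) := by rw [mul_add]; omega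
      _ ≤ Fintype.card V * (2 * Fintype.card V ^ t) := Nat.mul_le_mul_left _ ih
      _ = _ := by ring

/-- A form of the Gilbert–Varshamov bound for binary linear codes. -/
theorem exists_linearCode (hV : 2 ≤ Fintype.card V) {t r : ℕ} (hr : Fintype.card V ^ t ≤ 2 ^ r)
    (k : ℕ) (hk : k + r ≤ Fintype.card V) :
    ∃ C : Submodule (ZMod 2) (V → ZMod 2), Module.finrank (ZMod 2) C = k ∧
      ∀ c ∈ C, c ≠ 0 → t < hammingNorm c := by
  classical
  induction k with
  | zero => exact ⟨⊥, finrank_bot _ _, fun c hc h => absurd ((Submodule.mem_bot _).mp hc) h⟩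
  | succ k ih =>
    obtain ⟨C, hC, hmin⟩ := ih (by omega)
    set B := Finset.univ.filter fun x : V → ZMod 2 => hammingNorm x ≤ t with hB
    have hcard : ((Finset.univ.filter fun c => c ∈ C) ×ˢ B).card < 2 ^ Fintype.card V := by
      rw [Finset.card_product]
      have h1 : (Finset.univ.filter fun c => c ∈ C).card = 2 ^ k := by
        rw [← Fintype.card_subtype]
        exact (Module.card_eq_pow_finrank (K := ZMod 2) (V := C)).trans (by rw [ZMod.card, hC])
      rw [h1]
      -- The factor 2 in the ball bound is absorbed by passing from dimension `k` to `k + 1`.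
      calc 2 ^ k * B.card < 2 ^ k * (2 * Fintype.card V ^ t) :=
            Nat.mul_lt_mul_of_pos_left (card_hammingNorm_le_lt hV t) (by positivity)
        _ ≤ 2 ^ k * (2 * 2 ^ r) := by gcongr
        _ = 2 ^ (k + 1 + r) := by ring
        _ ≤ _ := Nat.pow_le_pow_right (by norm_num) hk
    -- The balls around the codewords do not fill the space; for an uncovered `x` the whole coset C
    -- + x has weights above `t`.
    have hex : ∃ x, x ∉ ((Finset.univ.filter fun c => c ∈ C) ×ˢ B).image fun p => p.1 + p.2 := by
      by_contra! h
      have h1 : Fintype.card (V → ZMod 2) ≤ _ :=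
        (Finset.card_le_card fun x (_ : x ∈ Finset.univ) => h x).trans Finset.card_image_le
      rw [Fintype.card_fun, ZMod.card] at h1
      omega
    obtain ⟨x, hx⟩ := hex
    have hx' : ∀ c ∈ C, t < hammingNorm (c + x) := by
      intro c hc
      by_contra! h
      refine hx (Finset.mem_image.mpr ⟨(c, c + x), ?_, ?_⟩)
      · simp [hB, hc, h]
      · simp [← add_assoc, ZModModule.add_self]
    have hxC : x ∉ C := fun h => by
      have := hx' x h
      rw [ZModModule.add_self] at this
      simp at this
    have hx0 : x ≠ 0 := by
      rintro rfl
      exact hxC C.zero_mem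
    refine ⟨C ⊔ Submodule.span (ZMod 2) {x}, ?_, ?_⟩
    · have hd : Disjoint C (Submodule.span (ZMod 2) {x}) :=
        (Submodule.disjoint_span_singleton' hx0).mpr hxC
      have := Submodule.finrank_sup_add_finrank_inf_eq C (Submodule.span (ZMod 2) {x})
      rw [hd.eq_bot, finrank_bot, hC, finrank_span_singleton hx0] at this
      omega
    · intro y hy hy0
      obtain ⟨c, hc, z, hz, rfl⟩ := Submodule.mem_sup.mp hy
      obtain ⟨l, rfl⟩ := Submodule.mem_span_singleton.mp hz
      have h : ∀ b : ZMod 2, b = 0 ∨ b = 1 := by decide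
      rcases h l with rfl | rfl
      · simp only [zero_smul, add_zero] at hy0 ⊢
        exact hmin c hc hy0
      · rw [one_smul]
        exact hx' c hc

end

/-! ### Slicing along a cycle -/

/-- A cyclic sequence of slices, of sizes `H` and weights `W`, has total weight at least `d + 2`,
if the weight of a slice next to its neighbours is at least `d`. -/
theorem cyclic_weight_bound {n : ℤ} (hn : 8 ≤ n) {H W : ℤ → ℕ} {d T : ℕ} (hd : 1 ≤ d)
    (hper : ∀ i j, j = i + n → H j = H i) (hHW : ∀ i, H i ≤ W i)
    (hmid : ∀ i j k, j = i + 1 → k = j + 1 → H j ≠ 0 → d ≤ W j + H i + H k)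
    (hleft : ∀ i j k, j = i + 1 → k = j + 1 → H i = 0 → H j = 0 → H k ≤ W j)
    (hright : ∀ i j k, j = i + 1 → k = j + 1 → H j = 0 → H k = 0 → H i ≤ W j)
    (hT : ∀ S : Finset ℤ, (∀ x ∈ S, ∀ y ∈ S, x - y < n) → ∑ i ∈ S, W i ≤ T)
    {t : ℤ} (ht : H t ≠ 0) : d + 2 ≤ T := by
  by_contra hlt
  -- Two non-empty slices this far apart have disjoint neighbourhoods, each of weight at least d,
  -- and 2d ≥ d + 2 if d ≥ 2. For d = 1 a third slice of positive weight is found at t + 1 or t + 2.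
  have far : ∀ t s, H t ≠ 0 → 3 ≤ s - t → s - t ≤ n - 3 → H s = 0 := by
    intro t s ht h1 h2
    by_contra hs
    have t0 := hHW t
    have s0 := hHW s
    by_cases hd2 : 2 ≤ d
    · have h := hT {t - 1, t, t + 1, s - 1, s, s + 1} (by simp; omega)
      repeat rw [Finset.sum_insert (by simp <;> omega)] at h
      rw [Finset.sum_singleton] at h
      have := hmid (t - 1) t (t + 1) (by ring) rfl ht
      have := hmid (s - 1) s (s + 1) (by ring) rfl hs
      have := hHW (t - 1)
      have := hHW (t + 1)
      have := hHW (s - 1)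
      have := hHW (s + 1)
      omega
    · have t1 := hHW (t + 1)
      have t2 := hHW (t + 2)
      have hr := hright t (t + 1) (t + 2) rfl (by ring)
      by_cases h : H (t + 1) = 0 ∧ H (t + 2) ≠ 0
      · have h := hT {t, t + 2, s} (by simp; omega)
        repeat rw [Finset.sum_insert (by simp <;> omega)] at h
        rw [Finset.sum_singleton] at h
        omega
      · have h := hT {t, t + 1, s} (by simp; omega)
        repeat rw [Finset.sum_insert (by simp <;> omega)] at h
        rw [Finset.sum_singleton] at h
        omega
  have far' : ∀ t s, H t ≠ 0 → 3 ≤ s + n - t → s - t ≤ - 3 → H s = 0 := fun t s ht h1 h2 => by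
    rw [← hper s (s + n) rfl]
    exact far t _ ht (by omega) (by omega)
  -- Move to the first slice of the cluster of non-empty slices.
  obtain ⟨t, ht, hm1, hm2⟩ : ∃ t, H t ≠ 0 ∧ H (t - 1) = 0 ∧ H (t - 2) = 0 := by
    by_cases h2 : H (t - 2) = 0
    · by_cases h1 : H (t - 1) = 0
      · exact ⟨t, ht, h1, h2⟩
      · exact ⟨t - 1, h1, by rwa [show t - 1 - 1 = t - 2 by ring],
          far' t _ ht (by omega) (by omega)⟩
    · exact ⟨t - 2, h2, far' t _ ht (by omega) (by omega), far' t _ ht (by omega) (by omega)⟩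
  have h3 : H (t + 3) = 0 := far t _ ht (by omega) (by omega)
  have h4 : H (t + 4) = 0 := far t _ ht (by omega) (by omega)
  have l1 := hleft (t - 2) (t - 1) t (by ring) (by ring) hm2 hm1
  have r1 := hright t (t + 1) (t + 2) (by ring) (by ring)
  have r2 := hright (t + 1) (t + 2) (t + 3) (by ring) (by ring)
  have r3 := hright (t + 2) (t + 3) (t + 4) (by ring) (by ring) h3 h4
  have m0 := hmid (t - 1) t (t + 1) (by ring) (by ring)
  have m1 := hmid t (t + 1) (t + 2) (by ring) (by ring)
  have w0 := hHW t
  have w1 := hHW (t + 1)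
  have w2 := hHW (t + 2)
  -- The empty slices just before and just after the cluster each have weight at least 1, since
  -- their Z part copies the adjacent non-empty slice. The slices of the cluster contribute at least
  -- d, by `hmid` and `hHW`.
  have h := hT {t - 1, t, t + 1, t + 2, t + 3} (by simp; omega)
  repeat rw [Finset.sum_insert (by simp <;> omega)] at h
  rw [Finset.sum_singleton] at h
  omega

theorem sum_intCast_le {n : ℕ} [NeZero n] (f : ZMod n → ℕ) (S : Finset ℤ)
    (hS : ∀ x ∈ S, ∀ y ∈ S, x - y < n) : ∑ j ∈ S, f j ≤ ∑ x, f x := by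
  classical
  have hinj : Set.InjOn (fun j : ℤ => (j : ZMod n)) S := by
    intro x hx y hy hxy
    have hdvd := (ZMod.intCast_eq_intCast_iff_dvd_sub x y n).mp hxy
    have h1 := hS x hx y hy
    have h2 := hS y hy x hx
    have := Int.eq_zero_of_abs_lt_dvd hdvd (abs_lt.mpr ⟨by omega, by omega⟩)
    omega
  rw [← Finset.sum_image (f := f) hinj]
  exact Finset.sum_le_sum_of_subset (Finset.subset_univ _)

section

variable {W : Type*} [Fintype W]

theorem hammingNorm_le_pauliWeight_left (a b : W → ZMod 2) : hammingNorm a ≤ pauliWeight a b :=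
  Finset.card_le_card fun i hi => by
    simp only [Finset.mem_filter, Finset.mem_univ, true_and, ne_eq, Prod.mk.injEq] at hi ⊢
    exact fun h => hi h.1

theorem hammingNorm_le_pauliWeight_right (a b : W → ZMod 2) : hammingNorm b ≤ pauliWeight a b :=
  Finset.card_le_card fun i hi => by
    simp only [Finset.mem_filter, Finset.mem_univ, true_and, ne_eq, Prod.mk.injEq] at hi ⊢
    exact fun h => hi h.2

variable [DecidableEq W]

theorem hammingNorm_add_le (a b : W → ZMod 2) :
    hammingNorm (a + b) ≤ hammingNorm a + hammingNorm b := by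
  refine (Finset.card_le_card fun i hi => ?_).trans (Finset.card_union_le _ _)
  simp only [Finset.mem_filter, Finset.mem_univ, true_and, Finset.mem_union, Pi.add_apply] at hi ⊢
  by_contra! h
  exact hi (by rw [h.1, h.2, add_zero])

theorem pauliWeight_le_add (a b c : W → ZMod 2) :
    pauliWeight a b ≤ pauliWeight a (b + c) + hammingNorm c := by
  refine (Finset.card_le_card fun i hi => ?_).trans (Finset.card_union_le _ _)
  simp only [Finset.mem_filter, Finset.mem_univ, true_and, Finset.mem_union, Pi.add_apply, ne_eq,
    Prod.mk.injEq] at hi ⊢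
  by_contra! h
  refine hi ⟨h.1.1, ?_⟩
  have := h.1.2
  rwa [h.2, add_zero] at this

/-- Slicing a cyclic lattice increases the weight of a stabilizer element by at least two. -/
theorem add_two_le_sum_pauliWeight {n : ℕ} [NeZero n] (hn : 8 ≤ n) {d : ℕ} (hd : 1 ≤ d)
    {Γ : (W → ZMod 2) → W → ZMod 2} (hΓ : Γ 0 = 0) (hw : ∀ a, a ≠ 0 → d ≤ pauliWeight a (Γ a))
    {b : ZMod n → W → ZMod 2} (hb : b ≠ 0) :
    d + 2 ≤ ∑ t, pauliWeight (b t) (Γ (b t) + (b (t + 1) + b (t - 1))) := by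
  obtain ⟨t, ht⟩ := Function.ne_iff.mp hb
  obtain ⟨t, rfl⟩ := ZMod.intCast_surjective t
  refine cyclic_weight_bound (n := n) (by exact_mod_cast hn)
    (H := fun j => hammingNorm (b j))
    (W := fun j => pauliWeight (b j) (Γ (b j) + (b (j + 1) + b (j - 1)))) hd ?_ ?_ ?_ ?_ ?_
    (fun S hS => sum_intCast_le
      (fun t => pauliWeight (b t) (Γ (b t) + (b (t + 1) + b (t - 1)))) S hS)
    (t := t) (hammingNorm_ne_zero_iff.mpr ht)
  · rintro i j rfl
    simp
  · intro i
    exact hammingNorm_le_pauliWeight_left _ _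
  · rintro i j k rfl rfl h
    have h1 := hw _ (hammingNorm_ne_zero_iff.mp h)
    -- Removing the Z contribution of the two adjacent slices leaves a stabilizer element of a
    -- single slice.
    have h2 := pauliWeight_le_add (b ↑(i + 1)) (Γ (b ↑(i + 1)))
      (b (↑(i + 1) + 1) + b (↑(i + 1) - 1))
    have h3 := hammingNorm_add_le (b (↑(i + 1) + 1)) (b (↑(i + 1) - 1))
    push_cast at h1 h2 h3 ⊢
    rw [add_sub_cancel_right] at h2 h3 ⊢
    omega
  · rintro i j k rfl rfl h1 h2
    rw [hammingNorm_eq_zero] at h1 h2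
    rw [h2, hΓ]
    push_cast
    rw [add_sub_cancel_right, h1]
    simpa using hammingNorm_le_pauliWeight_right 0 (b (i + 1 + 1))
  · rintro i j k rfl rfl h1 h2
    rw [hammingNorm_eq_zero] at h1 h2
    rw [h1, hΓ]
    push_cast at h2 ⊢
    rw [add_sub_cancel_right, h2]
    simpa using hammingNorm_le_pauliWeight_right 0 (b i)

end

/-! ### Recursive structure of the torus lattice -/

theorem min_natAbs_eq_one_iff {n : ℕ} (hn : 3 ≤ n + 1) (s t : Fin (n + 1)) :
    min ((s : ℤ) - (t : ℤ)).natAbs (n + 1 - ((s : ℤ) - (t : ℤ)).natAbs) = 1 ↔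
      t = s + 1 ∨ t = s - 1 := by
  have hs := s.isLt
  have ht := t.isLt
  have h1 : ((1 : Fin (n + 1)) : ℕ) = 1 := by
    rw [Fin.val_one']
    exact Nat.mod_eq_of_lt (by omega)
  have hadd : ((s + 1 : Fin (n + 1)) : ℕ) = if (s : ℕ) = n then 0 else (s : ℕ) + 1 := by
    rw [Fin.val_add, h1]
    split_ifs with h
    · rw [h, Nat.mod_self]
    · exact Nat.mod_eq_of_lt (by omega)
  have hsub : ((s - 1 : Fin (n + 1)) : ℕ) = if (s : ℕ) = 0 then n else (s : ℕ) - 1 := by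
    rw [Fin.val_sub, h1]
    split_ifs with h
    · rw [h]
      exact Nat.mod_eq_of_lt (by omega)
    · rw [show n + 1 - 1 + (s : ℕ) = (s - 1) + (n + 1) by omega, Nat.add_mod_right]
      exact Nat.mod_eq_of_lt (by omega)
  rw [Fin.ext_iff, Fin.ext_iff, hadd, hsub]
  split_ifs <;> omega

theorem leeDist_eq_zero_iff {D : ℕ} {n : Fin D → ℕ} (x y : ∀ i, Fin (n i)) :
    leeDist x y = 0 ↔ x = y := by
  rw [leeDist, Finset.sum_eq_zero_iff, funext_iff]
  refine forall_congr' fun i => ?_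
  have hx := (x i).isLt
  have hy := (y i).isLt
  rw [Fin.ext_iff]
  simp only [Finset.mem_univ, forall_const]
  omega

/-- Lee distance is additive over coordinates, and a sum of two naturals is 1 only as 0 + 1 or 1 +
0. -/
theorem torusLattice_cons_adj {D n : ℕ} (hn : 3 ≤ n + 1) (s t : Fin (n + 1))
    (x y : Fin D → Fin (n + 1)) :
    (torusLattice fun _ : Fin (D + 1) => n + 1).Adj
        (Fin.cons s x : Fin (D + 1) → Fin (n + 1)) (Fin.cons t y : Fin (D + 1) → Fin (n + 1)) ↔
      (t = s ∧ (torusLattice fun _ : Fin D => n + 1).Adj x y) ∨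
        (y = x ∧ (t = s + 1 ∨ t = s - 1)) := by
  change leeDist (D := D + 1) (n := fun _ => n + 1) _ _ = 1 ↔ (t = s ∧ leeDist x y = 1) ∨ _
  rw [← min_natAbs_eq_one_iff hn, @eq_comm _ y x, ← leeDist_eq_zero_iff x y]
  have h0 : min ((s : ℤ) - (t : ℤ)).natAbs (n + 1 - ((s : ℤ) - (t : ℤ)).natAbs) = 0 ↔ t = s := by
    have hs := s.isLt
    have ht := t.isLt
    rw [Fin.ext_iff]
    omega
  rw [← h0]
  have : leeDist (D := D + 1) (n := fun _ => n + 1)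
      (Fin.cons s x : Fin (D + 1) → Fin (n + 1)) (Fin.cons t y : Fin (D + 1) → Fin (n + 1)) =
      min ((s : ℤ) - (t : ℤ)).natAbs (n + 1 - ((s : ℤ) - (t : ℤ)).natAbs) + leeDist x y := by
    rw [leeDist, Fin.sum_univ_succ]
    simp only [Fin.cons_zero, Fin.cons_succ]
    rfl
  rw [this]
  generalize min ((s : ℤ) - (t : ℤ)).natAbs (n + 1 - ((s : ℤ) - (t : ℤ)).natAbs) = p
  omega

theorem sum_cons {D : ℕ} {α M : Type*} [Fintype α] [AddCommMonoid M] (f : (Fin (D + 1) → α) → M) :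
    ∑ x, f x = ∑ s, ∑ x, f (Fin.cons s x) := by
  rw [← (Fin.consEquiv fun _ : Fin (D + 1) => α).sum_comp f, Fintype.sum_prod_type]
  rfl

theorem neighborSum_torusLattice_cons {D n : ℕ} (hn : 3 ≤ n + 1)
    (a : (Fin (D + 1) → Fin (n + 1)) → ZMod 2) (s : Fin (n + 1)) (x : Fin D → Fin (n + 1)) :
    neighborSum (torusLattice fun _ : Fin (D + 1) => n + 1) a (Fin.cons s x) =
      neighborSum (torusLattice fun _ : Fin D => n + 1) (fun y => a (Fin.cons s y)) x +
        (a (Fin.cons (s + 1) x) + a (Fin.cons (s - 1) x)) := by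
  classical
  have hone : (1 : Fin (n + 1)) ≠ 0 := by
    rw [Ne, Fin.ext_iff, Fin.val_one', Fin.val_zero, Nat.mod_eq_of_lt (by omega)]
    exact one_ne_zero
  -- On a cycle of length 2 the two adjacent slices would coincide and cancel modulo 2.
  have htwo : s + 1 ≠ s - 1 := by
    intro h
    have h2 : (1 + 1 : Fin (n + 1)) = 0 := by
      have := congrArg (fun u => u - s + 1) h
      simpa using this
    rw [Fin.ext_iff, Fin.val_add, Fin.val_one', Fin.val_zero, Nat.mod_eq_of_lt (by omega : 1 < n + 1),
      Nat.mod_eq_of_lt (by omega)] at h2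
    omega
  have hne : ∀ t : Fin (n + 1), (t = s + 1 ∨ t = s - 1) → t ≠ s := by
    rintro t (rfl | rfl) h
    · exact hone (by simpa using h)
    · exact hone (by simpa using h)
  simp only [neighborSum]
  rw [sum_cons]
  have hsplit : ∀ t y, (if (torusLattice fun _ : Fin (D + 1) => n + 1).Adj
      (Fin.cons s x : Fin (D + 1) → Fin (n + 1)) (Fin.cons t y : Fin (D + 1) → Fin (n + 1))
      then a (Fin.cons t y) else 0) =
      (if t = s then if (torusLattice fun _ : Fin D => n + 1).Adj x y
        then a (Fin.cons t y) else 0 else 0) +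
      ((if y = x then if t = s + 1 then a (Fin.cons t y) else 0 else 0) +
      (if y = x then if t = s - 1 then a (Fin.cons t y) else 0 else 0)) := by
    intro t y
    simp only [torusLattice_cons_adj hn]
    by_cases h1 : t = s
    · have h3 : t ≠ s + 1 := fun h => hne t (Or.inl h) h1
      have h4 : t ≠ s - 1 := fun h => hne t (Or.inr h) h1
      simp only [h3, h4, or_self, and_false, or_false, if_false, ite_self, add_zero]
      simp only [h1, true_and, if_true]
    · simp only [h1, false_and, false_or, if_false, zero_add]
      by_cases h2 : y = x
      · simp only [h2, true_and, if_true]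
        by_cases h3 : t = s + 1
        · have h4 : t ≠ s - 1 := fun h => htwo (h3.symm.trans h)
          rw [if_pos (Or.inl h3), if_pos h3, if_neg h4, add_zero]
        · simp only [h3, false_or, if_false, zero_add]
      · simp only [h2, false_and, if_false, add_zero]
  simp only [hsplit, Finset.sum_add_distrib]
  congr 1
  · rw [Finset.sum_eq_single s]
    · simp
    · intro t _ ht
      simp [ht]
    · simp
  · simp

theorem pauliWeight_cons {D : ℕ} {α : Type*} [Fintype α] [DecidableEq α]
    (a b : (Fin (D + 1) → α) → ZMod 2) :
    pauliWeight a b =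
      ∑ s, pauliWeight (fun x => a (Fin.cons s x)) (fun x => b (Fin.cons s x)) := by
  simp only [pauliWeight, Finset.card_filter]
  exact sum_cons _

theorem hammingNorm_cons {D : ℕ} {α : Type*} [Fintype α] [DecidableEq α]
    (a : (Fin (D + 1) → α) → ZMod 2) :
    hammingNorm a = ∑ s, hammingNorm fun x => a (Fin.cons s x) := by
  simp only [hammingNorm, Finset.card_filter]
  exact sum_cons _

/-- The graph state of the `D`-dimensional torus lattice has distance at least `2 D + 1`. -/
theorem le_pauliWeight_neighborSum_torusLattice {n : ℕ} (hn : 8 ≤ n + 1) (D : ℕ) :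
    ∀ a : (Fin D → Fin (n + 1)) → ZMod 2, a ≠ 0 →
      2 * D + 1 ≤ pauliWeight a (neighborSum (torusLattice fun _ : Fin D => n + 1) a) := by
  induction D with
  | zero =>
    intro a ha
    have := hammingNorm_pos_iff.mpr ha
    have := hammingNorm_le_pauliWeight_left a
      (neighborSum (torusLattice fun _ : Fin 0 => n + 1) a)
    omega
  | succ D ih =>
    intro a ha
    have hb : (fun (s : Fin (n + 1)) x => a (Fin.cons s x)) ≠ 0 := by
      intro h
      apply ha
      ext x
      rw [← Fin.cons_self_tail x]
      exact congrFun (congrFun h (x 0)) (Fin.tail x)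
    -- `ZMod (n + 1)` unfolds to `Fin (n + 1)`, so the slices are already indexed as required.
    have h := add_two_le_sum_pauliWeight (n := n + 1) hn (by omega) (neighborSum_zero _) ih hb
    rw [pauliWeight_cons]
    simp only [neighborSum_torusLattice_cons (by omega : 3 ≤ n + 1)]
    exact h

/-- Each direction adds two shifted copies of `a`, and shifts preserve the total weight. -/
theorem hammingNorm_neighborSum_torusLattice_le {n : ℕ} (hn : 3 ≤ n + 1) (D : ℕ) :
    ∀ a : (Fin D → Fin (n + 1)) → ZMod 2,
      hammingNorm (neighborSum (torusLattice fun _ : Fin D => n + 1) a) ≤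
        2 * D * hammingNorm a := by
  induction D with
  | zero =>
    intro a
    have : neighborSum (torusLattice fun _ : Fin 0 => n + 1) a = 0 := by
      ext x
      simp [neighborSum, Subsingleton.elim _ x]
    simp [this]
  | succ D ih =>
    intro a
    rw [hammingNorm_cons, hammingNorm_cons a]
    simp only [neighborSum_torusLattice_cons hn]
    set f : Fin (n + 1) → ℕ := fun s => hammingNorm fun x => a (Fin.cons s x) with hf
    have h : ∀ s, (hammingNorm fun x =>
        neighborSum (torusLattice fun _ : Fin D => n + 1) (fun y => a (Fin.cons s y)) x +
          (a (Fin.cons (s + 1) x) + a (Fin.cons (s - 1) x))) ≤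
        2 * D * f s + (f (s + 1) + f (s - 1)) := fun s =>
      (hammingNorm_add_le _ _).trans (add_le_add (ih _) (hammingNorm_add_le _ _))
    refine (Finset.sum_le_sum fun s _ => h s).trans (le_of_eq ?_)
    have e1 : ∑ s, f (s + 1) = ∑ s, f s := Equiv.sum_comp (Equiv.addRight 1) f
    have e2 : ∑ s, f (s - 1) = ∑ s, f s := Equiv.sum_comp (Equiv.subRight 1) f
    rw [Finset.sum_add_distrib, Finset.sum_add_distrib, e1, e2, ← Finset.mul_sum]
    ring

end CWS

/-! ### Assembling the code -/

theorem corollary2 (D : ℕ) (hD : 1 ≤ D) (n : ℕ) (hn : 8 ≤ n) (k : ℕ)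
    (hk : (k : ℤ) = (n : ℤ) ^ D - ⌈2 * (D : ℝ) ^ 2 * (2 * (D : ℝ) + 1) * Real.logb 2 (n : ℝ)⌉) :
    ∃ C : Submodule (ZMod 2) ((∀ _ : Fin D, Fin n) → ZMod 2),
      Module.finrank (ZMod 2) C = k ∧
      (∀ c ∈ C, c ≠ 0 → 2 * D * (2 * D + 1) < hammingNorm c) ∧
      (∃ ψ, CWS.IsGraphState (CWS.torusLattice fun _ : Fin D => n) ψ) ∧
      ∀ ψ, CWS.IsGraphState (CWS.torusLattice fun _ : Fin D => n) ψ →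
        CWS.IsPureCode (n ^ D) k (2 * D + 1) (CWS.cwsCode ψ C) := by
  obtain ⟨m, rfl⟩ : ∃ m, n = m + 1 := ⟨n - 1, by omega⟩
  have hcard : Fintype.card (Fin D → Fin (m + 1)) = (m + 1) ^ D := by simp
  set L : ℝ := 2 * (D : ℝ) ^ 2 * (2 * (D : ℝ) + 1) * Real.logb 2 ((m + 1 : ℕ) : ℝ) with hL
  have hL0 : 0 ≤ L := by
    have : 0 ≤ Real.logb 2 ((m + 1 : ℕ) : ℝ) :=
      Real.logb_nonneg (by norm_num) (by exact_mod_cast Nat.le_add_left 1 m)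
    positivity
  obtain ⟨r, hr⟩ := Int.eq_ofNat_of_zero_le (Int.ceil_nonneg hL0)
  have hkr : k + r = (m + 1) ^ D := by
    rw [hr] at hk
    zify
    push_cast at hk
    linarith
  -- The left side equals 2 ^ L, and r = ⌈L⌉.
  have hball : Fintype.card (Fin D → Fin (m + 1)) ^ (2 * D * (2 * D + 1)) ≤ 2 ^ r := by
    rw [hcard]
    have hLr : L ≤ r := by
      have := Int.le_ceil L
      rw [hr] at this
      exact_mod_cast this
    have h : (((m + 1 : ℕ) : ℝ) ^ D) ^ (2 * D * (2 * D + 1)) ≤ 2 ^ r := by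
      calc (((m + 1 : ℕ) : ℝ) ^ D) ^ (2 * D * (2 * D + 1))
          = ((2 : ℝ) ^ Real.logb 2 ((m + 1 : ℕ) : ℝ)) ^ (D * (2 * D * (2 * D + 1))) := by
            rw [← pow_mul, Real.rpow_logb (by norm_num) (by norm_num) (by positivity)]
        _ = (2 : ℝ) ^ L := by
            rw [← Real.rpow_natCast, ← Real.rpow_mul (by norm_num), hL]
            congr 1
            push_cast
            ring
        _ ≤ (2 : ℝ) ^ (r : ℝ) := Real.rpow_le_rpow_of_exponent_le (by norm_num) hLr
        _ = 2 ^ r := Real.rpow_natCast _ _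
    exact_mod_cast h
  have htwo : 2 ≤ Fintype.card (Fin D → Fin (m + 1)) := by
    rw [hcard]
    calc 2 ≤ m + 1 := by omega
      _ ≤ (m + 1) ^ D := Nat.le_self_pow (by omega) _
  obtain ⟨C, hC, hmin⟩ := CWS.exists_linearCode htwo hball k (by rw [hcard, hkr])
  refine ⟨C, hC, hmin, CWS.exists_isGraphState _, fun ψ hψ => ⟨hcard, ?_, ?_⟩⟩
  · rw [hψ.finrank_cwsCode, hC]
  intro p a b hpos hlt φ hφ
  refine hψ.inner_pauliOp_eq_zero p (fun hmem => ?_) hφ hφ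
  have hnorm : hammingNorm (b + CWS.neighborSum (CWS.torusLattice fun _ : Fin D => m + 1) a) ≤
      2 * D * (2 * D + 1) := by
    have h1 := CWS.hammingNorm_add_le b
      (CWS.neighborSum (CWS.torusLattice fun _ : Fin D => m + 1) a)
    have h2 := CWS.hammingNorm_neighborSum_torusLattice_le (by omega : 3 ≤ m + 1) D a
    have h3 := CWS.hammingNorm_le_pauliWeight_left a b
    have h4 := CWS.hammingNorm_le_pauliWeight_right a b
    have h5 : CWS.pauliWeight a b ≤ 2 * D := by omega
    nlinarith
  have hzero : b + CWS.neighborSum (CWS.torusLattice fun _ : Fin D => m + 1) a = 0 := by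
    by_contra h
    exact absurd (hmin _ hmem h) (by omega)
  rw [← ZModModule.sub_eq_add, sub_eq_zero] at hzero
  -- The operator is now a phase times a stabilizer element: it has weight 0 if a = 0, and weight at
  -- least 2D + 1 otherwise.
  subst hzero
  by_cases ha : a = 0
  · subst ha
    rw [CWS.neighborSum_zero] at hpos
    simp [CWS.pauliWeight] at hpos
  · have := CWS.le_pauliWeight_neighborSum_torusLattice hn D a ha
    omega
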